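/- Let $L$ be a non-empty locally compact Hausdorff space, let $C_0(L)$ be the Banach space (sup norm) of real-valued, respectively complex-valued, continuous functions on $L$ vanishing at infinity, and let $Y$ be a Banach space over the same scalar field. For every $\varepsilon>0$, every compact linear operator $T\colon C_0(L)\to Y$ and every $f_0\in C_0(L)$ there exist a finite positive regular Borel measure $\mu$ on $L$, a non-negative integer $m$, pairwise disjoint compact sets $K_1,\dots,K_m\subset L$ with $\mu(K_j)>0$, and functions $\varphi_1,\dots,\varphi_m\in C_0(L)$ such that: 1. $\sup_{x,y\in K_j}|f_0(x)-f_0(y)|<\varepsilon$ for every $j$; 2. $0\le\varphi_j\le 1$ on $L$ and $\varphi_j\equiv 1$ on $K_j$ for every $j$; 3. $\operatorname{supp}\varphi_i\cap\operatorname{supp}\varphi_j=\emptyset$ for $i\ne j$, where $\operatorname{supp}\varphi$ is the closure of $\{x\in L:\varphi(x)\ne0\}$; 4. the operator $P\colon C_0(L)\to C_0(L)$ given by $$P(f)=\sum_{j=1}^m\frac{1}{\mu(K_j)}\Bigl(\int_{K_j}f\,d\mu\Bigr)\varphi_j,\qquad f\in C_0(L),$$ is a bounded linear projection ($P^2=P$)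 of norm $\|P\|=1$ whose range is the linear span of $\{\varphi_1,\dots,\varphi_m\}$, and $\|T-TP\|<\varepsilon$. -/

import Mathlib

open scoped ZeroAtInfty

/-- The oscillation of a scalar function `f` on a set `S`: the supremum of `‖f x - f y‖`
over `x, y ∈ S`. -/
noncomputable def setOsc {L 𝕜 : Type*} [RCLike 𝕜] (f : L → 𝕜) (S : Set L) : ℝ :=
  sSup (Set.image2 (fun x y => ‖f x - f y‖) S S)

open scoped NNReal CompactlySupported Topology
open MeasureTheory

/-! ### The modulus of a bounded functional. -/

namespace ZeroAtInftyContinuousMap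

variable {𝕜 L : Type*} [RCLike 𝕜] [TopologicalSpace L]

/-! Since `T` is compact, its adjoint sends the dual unit ball close to finitely many functionals `Λ
i` (`IsCompactOperator.exists_finite_norm_sub_comp_le`). These are dominated by one finite regular
measure `μ`, the Riesz measure of the sum of their moduli plus a point evaluation
(`exists_measure_norm_le_integral`), so each has an integrable density `w i` (`exists_density`).

Approximate all `w i` in `L¹` by simple functions and `f₀` uniformly by another. Compact subsets `K
j` of the common non-null fibres fill `μ` up to a small remainder
(`exists_isCompact_norm_integral_mul_le`). The averaging projection `P` preserves integrals over
each `K j`, so `g = f - P f` has mean zero there: the simple functions see `g` only on the small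
remainder, and every `Λ i g` is small. Testing `T g` against a norming functional then bounds `‖T
g‖`. -/

theorem norm_le_iff {f : C₀(L, 𝕜)} {C : ℝ} (hC : 0 ≤ C) : ‖f‖ ≤ C ↔ ∀ x, ‖f x‖ ≤ C := by
  rw [← norm_toBCF_eq_norm, BoundedContinuousFunction.norm_le hC]; rfl

theorem norm_apply_le (f : C₀(L, 𝕜)) (x : L) : ‖f x‖ ≤ ‖f‖ :=
  (norm_le_iff (norm_nonneg f)).1 le_rfl x

/-- A continuous function dominated by a function vanishing at infinity vanishes at infinity. -/
def ofNormLe (g : C₀(L, 𝕜)) (v : L → 𝕜) (hv : Continuous v) (h : ∀ x, ‖v x‖ ≤ ‖g x‖) :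
    C₀(L, 𝕜) where
  toFun := v
  continuous_toFun := hv
  zero_at_infty' := squeeze_zero_norm h (by simpa using g.zero_at_infty'.norm)

@[simp] theorem ofNormLe_apply (g : C₀(L, 𝕜)) (v : L → 𝕜) (hv : Continuous v)
    (h : ∀ x, ‖v x‖ ≤ ‖g x‖) (x : L) : ofNormLe g v hv h x = v x := rfl

/-- The modulus of a bounded functional on `C₀(L, 𝕜)`, evaluated at a nonnegative compactly
supported function. -/
noncomputable def dualAbs (Λ : StrongDual 𝕜 C₀(L, 𝕜)) (f : C_c(L, ℝ≥0)) : ℝ≥0 :=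
  ⨆ g : {g : C₀(L, 𝕜) // ∀ x, ‖g x‖₊ ≤ f x}, ‖Λ g‖₊

variable (Λ : StrongDual 𝕜 C₀(L, 𝕜))

theorem nnnorm_le_of_forall_le {f : C_c(L, ℝ≥0)} {C : ℝ≥0} (hC : ∀ x, f x ≤ C)
    (g : {g : C₀(L, 𝕜) // ∀ x, ‖g x‖₊ ≤ f x}) : ‖Λ g‖₊ ≤ ‖Λ‖₊ * C := by
  refine (Λ.le_opNNNorm g).trans ?_
  gcongr
  exact (norm_le_iff C.2).2 fun x => by exact_mod_cast (g.2 x).trans (hC x)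

theorem dualAbs_le {f : C_c(L, ℝ≥0)} {C : ℝ≥0} (hC : ∀ x, f x ≤ C) :
    dualAbs Λ f ≤ ‖Λ‖₊ * C :=
  ciSup_le' (nnnorm_le_of_forall_le Λ hC)

theorem exists_forall_apply_le (f : C_c(L, ℝ≥0)) : ∃ C : ℝ≥0, ∀ x, f x ≤ C := by
  obtain ⟨C, hC⟩ := f.hasCompactSupport.isCompact_range (map_continuous f) |>.bddAbove
  exact ⟨C, fun x => hC ⟨x, rfl⟩⟩

theorem le_dualAbs {f : C_c(L, ℝ≥0)} {g : C₀(L, 𝕜)} (hg : ∀ x, ‖g x‖₊ ≤ f x) :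
    ‖Λ g‖₊ ≤ dualAbs Λ f := by
  obtain ⟨C, hC⟩ := exists_forall_apply_le f
  exact le_ciSup (f := fun g : {g : C₀(L, 𝕜) // ∀ x, ‖g x‖₊ ≤ f x} => ‖Λ g‖₊)
    ⟨‖Λ‖₊ * C, by rintro _ ⟨g, rfl⟩; exact nnnorm_le_of_forall_le Λ hC g⟩ ⟨g, hg⟩

/-- A function `g` dominated by `f₁ + f₂` is split in the proportion `f₁ : f₂`. Adding `η` to the
denominator keeps the quotients continuous; it creates a third piece of norm at most `η`, which
costs `‖Λ‖ * η`. -/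
theorem dualAbs_add_le (f₁ f₂ : C_c(L, ℝ≥0)) :
    dualAbs Λ (f₁ + f₂) ≤ dualAbs Λ f₁ + dualAbs Λ f₂ := by
  refine ciSup_le' fun ⟨g, hg⟩ => ?_
  have key : ∀ η : ℝ, 0 < η → ‖Λ g‖ ≤ (dualAbs Λ f₁ + dualAbs Λ f₂ : ℝ≥0) + ‖Λ‖ * η := by
    intro η hη
    set D : L → ℝ := fun x => f₁ x + f₂ x + η with hD
    have hDpos : ∀ x, 0 < D x := fun x => by positivity
    have hDc : Continuous D := by fun_prop
    have hgx : ∀ x, ‖g x‖ ≤ f₁ x + f₂ x := fun x => by exact_mod_cast hg x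
    have hc : ∀ u : L → ℝ, Continuous u → Continuous fun x => g x * ((u x / D x : ℝ) : 𝕜) :=
      fun u hu => (map_continuous g).mul
        (RCLike.continuous_ofReal.comp (hu.div hDc fun x => (hDpos x).ne'))
    have hn : ∀ u : L → ℝ, (∀ x, 0 ≤ u x) → ∀ x, ‖g x * ((u x / D x : ℝ) : 𝕜)‖
        = ‖g x‖ * (u x / D x) := fun u hu x => by
      rw [norm_mul, RCLike.norm_ofReal, abs_of_nonneg (div_nonneg (hu x) (hDpos x).le)]
    have hle : ∀ u : L → ℝ, (∀ x, 0 ≤ u x) → (∀ x, u x ≤ D x) →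
        ∀ x, ‖g x * ((u x / D x : ℝ) : 𝕜)‖ ≤ ‖g x‖ := fun u hu hu' x => by
      rw [hn u hu]
      exact mul_le_of_le_one_right (norm_nonneg _) ((div_le_one (hDpos x)).2 (hu' x))
    have hsm : ∀ u : L → ℝ, (∀ x, 0 ≤ u x) → ∀ x, ‖g x * ((u x / D x : ℝ) : 𝕜)‖ ≤ u x :=
      fun u hu x => by
        rw [hn u hu, mul_div_assoc', div_le_iff₀ (hDpos x), mul_comm]
        exact mul_le_mul_of_nonneg_left ((hgx x).trans (by simp [hD, hη.le])) (hu x)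
    let G : (u : L → ℝ) → Continuous u → (∀ x, 0 ≤ u x) → (∀ x, u x ≤ D x) → C₀(L, 𝕜) :=
      fun u hu h0 h1 => ofNormLe g _ (hc u hu) (hle u h0 h1)
    let g₁ := G (fun x => f₁ x) (by fun_prop) (fun x => (f₁ x).2)
      (fun x => by have := (f₂ x).2; simp only [hD]; linarith)
    let g₂ := G (fun x => f₂ x) (by fun_prop) (fun x => (f₂ x).2)
      (fun x => by have := (f₁ x).2; simp only [hD]; linarith)
    let g₃ := G (fun _ => η) (by fun_prop) (fun _ => hη.le)
      (fun x => by have := (f₁ x).2; have := (f₂ x).2; simp only [hD]; linarith)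
    have hsum : g = g₁ + g₂ + g₃ := by
      ext x
      change g x = g x * _ + g x * _ + g x * _
      rw [← mul_add, ← mul_add, ← RCLike.ofReal_add, ← RCLike.ofReal_add, ← add_div, ← add_div,
        div_self (hDpos x).ne', RCLike.ofReal_one, mul_one]
    have h1 : ‖Λ g₁‖₊ ≤ dualAbs Λ f₁ := le_dualAbs Λ fun x => hsm _ (fun x => (f₁ x).2) x
    have h2 : ‖Λ g₂‖₊ ≤ dualAbs Λ f₂ := le_dualAbs Λ fun x => hsm _ (fun x => (f₂ x).2) x
    have h3 : ‖Λ g₃‖ ≤ ‖Λ‖ * η := (Λ.le_opNorm _).trans <| by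
      gcongr
      exact (norm_le_iff hη.le).2 fun x => hsm _ (fun x => hη.le) x
    calc ‖Λ g‖ = ‖Λ g₁ + Λ g₂ + Λ g₃‖ := by rw [hsum, map_add, map_add]
      _ ≤ ‖Λ g₁‖ + ‖Λ g₂‖ + ‖Λ g₃‖ := norm_add₃_le
      _ ≤ _ := by
        push_cast
        exact add_le_add (add_le_add (by exact_mod_cast h1) (by exact_mod_cast h2)) h3
  refine NNReal.coe_le_coe.1 (le_of_forall_pos_le_add fun ρ hρ => ?_)
  refine (key (ρ / (‖Λ‖ + 1)) (by positivity)).trans ?_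
  gcongr
  rw [mul_div_assoc', div_le_iff₀ (by positivity)]
  nlinarith [norm_nonneg Λ]

/-- Unimodular factors make `Λ g₁` and `Λ g₂` nonnegative reals, so they add without cancellation,
while the pointwise bounds are unaffected. -/
theorem add_le_dualAbs (f₁ f₂ : C_c(L, ℝ≥0)) :
    dualAbs Λ f₁ + dualAbs Λ f₂ ≤ dualAbs Λ (f₁ + f₂) := by
  suffices H : ∀ g₁ g₂ : C₀(L, 𝕜), (∀ x, ‖g₁ x‖₊ ≤ f₁ x) → (∀ x, ‖g₂ x‖₊ ≤ f₂ x) →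
      ‖Λ g₁‖₊ + ‖Λ g₂‖₊ ≤ dualAbs Λ (f₁ + f₂) by
    -- The two suprema are taken one at a time. Subtraction in `ℝ≥0` is truncated, hence the side
    -- bounds `h₀` and `h₃`.
    have h₁ : ∀ g₂ : C₀(L, 𝕜), (∀ x, ‖g₂ x‖₊ ≤ f₂ x) →
        dualAbs Λ f₁ ≤ dualAbs Λ (f₁ + f₂) - ‖Λ g₂‖₊ := fun g₂ h₂ =>
      ciSup_le' fun g₁ => le_tsub_of_add_le_right (H g₁ g₂ g₁.2 h₂)
    have h₀ : dualAbs Λ f₁ ≤ dualAbs Λ (f₁ + f₂) := (h₁ 0 (by simp)).trans tsub_le_self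
    have h₂ : dualAbs Λ f₂ ≤ dualAbs Λ (f₁ + f₂) - dualAbs Λ f₁ := ciSup_le' fun g₂ => by
      have h₃ : ‖Λ g₂‖₊ ≤ dualAbs Λ (f₁ + f₂) :=
        le_of_add_le_right (H 0 g₂ (by simp) g₂.2)
      exact le_tsub_of_add_le_left ((le_tsub_iff_right h₃).1 (h₁ g₂ g₂.2))
    rw [add_comm]
    exact (le_tsub_iff_right h₀).1 h₂
  intro g₁ g₂ h₁ h₂
  obtain ⟨c₁, hc₁, e₁⟩ := RCLike.exists_norm_eq_mul_self (Λ g₁)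
  obtain ⟨c₂, hc₂, e₂⟩ := RCLike.exists_norm_eq_mul_self (Λ g₂)
  have : ‖Λ (c₁ • g₁ + c₂ • g₂)‖₊ = ‖Λ g₁‖₊ + ‖Λ g₂‖₊ := by
    ext
    rw [map_add, map_smul, map_smul, smul_eq_mul, smul_eq_mul, ← e₁, ← e₂, coe_nnnorm,
      ← RCLike.ofReal_add, RCLike.norm_ofReal, abs_of_nonneg (by positivity)]
    rfl
  rw [← this]
  refine le_dualAbs Λ fun x => (nnnorm_add_le _ _).trans (add_le_add ?_ ?_)
  · have : ‖c₁‖₊ = 1 := by ext; exact hc₁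
    simpa [nnnorm_smul, this] using h₁ x
  · have : ‖c₂‖₊ = 1 := by ext; exact hc₂
    simpa [nnnorm_smul, this] using h₂ x

theorem smul_dualAbs_le (r : ℝ≥0) (f : C_c(L, ℝ≥0)) : r * dualAbs Λ f ≤ dualAbs Λ (r • f) := by
  rw [dualAbs, NNReal.mul_iSup]
  refine ciSup_le' fun ⟨g, hg⟩ => ?_
  have : r * ‖Λ g‖₊ = ‖Λ (((r : ℝ) : 𝕜) • g)‖₊ := by
    ext; simp
  change r * ‖Λ g‖₊ ≤ _
  rw [this]
  refine le_dualAbs Λ fun x => ?_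
  have : ‖((r : ℝ) : 𝕜)‖₊ = r := by ext; simp
  simpa [nnnorm_smul, this] using mul_le_mul_right (hg x) r

theorem dualAbs_smul (r : ℝ≥0) (f : C_c(L, ℝ≥0)) : dualAbs Λ (r • f) = r * dualAbs Λ f := by
  refine le_antisymm ?_ (smul_dualAbs_le Λ r f)
  rcases eq_or_ne r 0 with rfl | hr
  · rw [zero_mul]
    simpa using dualAbs_le Λ (f := (0 : ℝ≥0) • f) (C := 0) (by simp)
  · have := smul_dualAbs_le Λ r⁻¹ (r • f)
    rwa [smul_smul, inv_mul_cancel₀ hr, one_smul, inv_mul_le_iff₀ (pos_iff_ne_zero.2 hr)] at this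

/-- The modulus of a bounded functional on `C₀(L, 𝕜)` as a positive functional. -/
noncomputable def dualAbsₗ : C_c(L, ℝ≥0) →ₗ[ℝ≥0] ℝ≥0 where
  toFun := dualAbs Λ
  map_add' f₁ f₂ := le_antisymm (dualAbs_add_le Λ f₁ f₂) (add_le_dualAbs Λ f₁ f₂)
  map_smul' := dualAbs_smul Λ

/-! ### Densities through Hilbert space duality. -/

variable [MeasurableSpace L] [BorelSpace L]

theorem integrable (f : C₀(L, 𝕜)) (μ : Measure L) [IsFiniteMeasure μ] : Integrable f μ :=
  f.toBCF.integrable μ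

/-- A bounded functional dominated by integration of the norm has a density. -/
theorem exists_density {μ : Measure L} [IsFiniteMeasure μ]
    (h : ∀ f, ‖Λ f‖ ≤ ∫ x, ‖f x‖ ∂μ) :
    ∃ w : L → 𝕜, Integrable w μ ∧ ∀ f : C₀(L, 𝕜), Λ f = ∫ x, f x * w x ∂μ := by
  have hm : ∀ f : C₀(L, 𝕜), MemLp f 2 μ := fun f =>
    MemLp.of_bound (f.integrable μ).1 ‖f‖ (Filter.Eventually.of_forall (norm_apply_le f))
  let e : C₀(L, 𝕜) →ₗ[𝕜] Lp 𝕜 2 μ :=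
    { toFun := fun f => (hm f).toLp f
      map_add' := fun f g => rfl
      map_smul' := fun c f => rfl }
  obtain ⟨C, hC⟩ : ∃ C : ℝ, ∀ f : C₀(L, 𝕜), ‖Λ f‖ ≤ C * ‖e f‖ := by
    refine ⟨(μ Set.univ ^ (1 / (1 : ENNReal).toReal - 1 / (2 : ENNReal).toReal)).toReal,
      fun f => (h f).trans ?_⟩
    have := eLpNorm_le_eLpNorm_mul_rpow_measure_univ (p := 1) (q := 2) (μ := μ) (f := f)
      (by norm_num) (f.integrable μ).1
    rw [integral_norm_eq_lintegral_enorm (f.integrable μ).1, ← eLpNorm_one_eq_lintegral_enorm,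
      mul_comm]
    change _ ≤ ‖(hm f).toLp f‖ * _
    rw [Lp.norm_toLp, ← ENNReal.toReal_mul]
    refine ENNReal.toReal_mono (ENNReal.mul_ne_top (hm f).2.ne ?_) this
    exact ENNReal.rpow_ne_top_of_nonneg (by norm_num) (measure_ne_top _ _)
  -- `Λ` factors through the image of `C₀` in `L²`: by `hC` it vanishes on the kernel of `e`, so a
  -- merely linear section `s` suffices. Hahn–Banach and Fréchet–Riesz then represent it.
  obtain ⟨s, hs⟩ := e.rangeRestrict.exists_rightInverse_of_surjective e.range_rangeRestrict
  have hs' : ∀ v, e (s v) = v := fun v => congrArg Subtype.val (LinearMap.congr_fun hs v)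
  let G : StrongDual 𝕜 (LinearMap.range e) := ((Λ : C₀(L, 𝕜) →ₗ[𝕜] 𝕜) ∘ₗ s).mkContinuous C
    fun v => (hC (s v)).trans (by rw [hs']; rfl)
  obtain ⟨H, hH, -⟩ := exists_extension_norm_eq _ G
  have hHΛ : ∀ f, H (e f) = Λ f := fun f => by
    rw [hH ⟨e f, f, rfl⟩]
    change Λ (s ⟨e f, f, rfl⟩) = Λ f
    have := hC (s ⟨e f, f, rfl⟩ - f)
    rw [map_sub e, hs', sub_self, norm_zero, mul_zero, norm_le_zero_iff, map_sub] at this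
    exact sub_eq_zero.1 this
  let u := (InnerProductSpace.toDual 𝕜 (Lp 𝕜 2 μ)).symm H
  refine ⟨fun x => star (u x), ?_, fun f => ?_⟩
  · exact (RCLike.conjCLE (K := 𝕜)).toContinuousLinearMap.integrable_comp
      ((Lp.memLp u).integrable (by norm_num))
  · rw [← hHΛ, ← InnerProductSpace.toDual_symm_apply, L2.inner_def]
    refine integral_congr_ae ?_
    filter_upwards [(hm f).coeFn_toLp] with x hx
    change inner 𝕜 (u x) ((hm f).toLp f x) = _
    rw [hx, RCLike.inner_apply]
    rfl

/-! ### A common dominating measure. -/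

variable [T2Space L] [LocallyCompactSpace L]

/-- The hypothesis only concerns compactly supported functions, so `f` is cut off by a Urysohn
function equal to one where `‖f‖` is not small. -/
theorem norm_le_integral {μ : Measure L}
    (h : ∀ f, (dualAbs Λ f : ENNReal) ≤ ∫⁻ x, f x ∂μ) [IsFiniteMeasure μ] (f : C₀(L, 𝕜)) :
    ‖Λ f‖ ≤ ∫ x, ‖f x‖ ∂μ := by
  refine le_of_forall_pos_le_add fun ρ hρ => ?_
  set η : ℝ := ρ / (‖Λ‖ + 1) with hη
  have hη0 : 0 < η := by positivity
  obtain ⟨K, hK, hKf⟩ : ∃ K, IsCompact K ∧ ∀ x ∉ K, ‖f x‖ < η := by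
    have := (Metric.tendsto_nhds.1 f.zero_at_infty' η hη0)
    obtain ⟨K, hK, hKf⟩ := Filter.hasBasis_cocompact.eventually_iff.1 this
    exact ⟨K, hK, fun x hx => by simpa using hKf hx⟩
  obtain ⟨ψ, hψ1, hψc, -, hψ⟩ :=
    exists_continuousMap_one_of_isCompact_subset_isOpen hK isOpen_univ (Set.subset_univ K)
  have hle : ∀ x, ‖f x * (ψ x : 𝕜)‖ ≤ ‖f x‖ := fun x => by
    rw [norm_mul, RCLike.norm_ofReal, abs_of_nonneg (hψ x).1]
    exact mul_le_of_le_one_right (norm_nonneg _) (hψ x).2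
  have hcont : Continuous fun x => f x * (ψ x : 𝕜) :=
    (map_continuous f).mul (RCLike.continuous_ofReal.comp ψ.continuous)
  let g := ofNormLe f _ hcont hle
  let F : C_c(L, ℝ≥0) := ⟨⟨fun x => ‖f x * (ψ x : 𝕜)‖₊, hcont.nnnorm⟩, by
    refine HasCompactSupport.intro hψc fun x hx => ?_
    simp [image_eq_zero_of_notMem_tsupport hx]⟩
  have h1 : ‖Λ g‖ ≤ ∫ x, ‖f x‖ ∂μ := by
    have h2 : ENNReal.ofReal ‖Λ g‖ ≤ ENNReal.ofReal (∫ x, ‖f x‖ ∂μ) := by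
      rw [ofReal_integral_norm_eq_lintegral_enorm (f.integrable μ), ofReal_norm]
      calc ‖Λ g‖ₑ ≤ dualAbs Λ F := ENNReal.coe_le_coe.2 (le_dualAbs Λ fun x => le_rfl)
        _ ≤ ∫⁻ x, F x ∂μ := h F
        _ ≤ _ := lintegral_mono fun x => ENNReal.coe_le_coe.2 (hle x)
    exact (ENNReal.ofReal_le_ofReal_iff (integral_nonneg fun _ => norm_nonneg _)).1 h2
  have h3 : ‖f - g‖ ≤ η := by
    refine (norm_le_iff hη0.le).2 fun x => ?_
    change ‖f x - f x * (ψ x : 𝕜)‖ ≤ η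
    by_cases hx : x ∈ K
    · simp [hψ1 hx, hη0.le]
    · rw [← mul_one_sub, ← RCLike.ofReal_one, ← RCLike.ofReal_sub, norm_mul, RCLike.norm_ofReal,
        abs_of_nonneg (sub_nonneg.2 (hψ x).2)]
      exact (mul_le_of_le_one_right (norm_nonneg _) (by linarith [(hψ x).1])).trans (hKf x hx).le
  calc ‖Λ f‖ = ‖Λ g + Λ (f - g)‖ := by rw [← map_add]; congr 2; abel
    _ ≤ ‖Λ g‖ + ‖Λ‖ * ‖f - g‖ := (norm_add_le _ _).trans (by gcongr; exact Λ.le_opNorm _)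
    _ ≤ _ := by
      gcongr
      calc ‖Λ‖ * ‖f - g‖ ≤ (‖Λ‖ + 1) * η := by gcongr; simp
        _ = ρ := by rw [hη]; field_simp

/-- By inner regularity it suffices to bound compact sets, and a Urysohn function above the
indicator of `K` does so. -/
theorem isFiniteMeasure_rieszMeasure (Φ : C_c(L, ℝ≥0) →ₗ[ℝ≥0] ℝ≥0) (C : ℝ≥0)
    (h : ∀ f : C_c(L, ℝ≥0), (∀ x, f x ≤ 1) → Φ f ≤ C) :
    IsFiniteMeasure (NNRealRMK.rieszMeasure Φ) := by
  refine ⟨lt_of_le_of_lt ?_ (ENNReal.coe_lt_top (r := C))⟩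
  have := NNRealRMK.rieszMeasure_regular Φ
  rw [isOpen_univ.measure_eq_iSup_isCompact]
  refine iSup_le fun K => iSup_le fun _ => iSup_le fun hK => ?_
  obtain ⟨ψ, hψ1, hψc, -, hψ⟩ :=
    exists_continuousMap_one_of_isCompact_subset_isOpen hK isOpen_univ (Set.subset_univ K)
  let F : C_c(L, ℝ≥0) := ⟨⟨fun x => (ψ x).toNNReal, by fun_prop⟩, by
    refine HasCompactSupport.intro hψc fun x hx => ?_
    simp [image_eq_zero_of_notMem_tsupport hx]⟩
  calc NNRealRMK.rieszMeasure Φ K = ∫⁻ x in K, 1 ∂(NNRealRMK.rieszMeasure Φ) := by simp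
    _ ≤ ∫⁻ x in K, F x ∂(NNRealRMK.rieszMeasure Φ) := by
      refine setLIntegral_mono' hK.measurableSet fun x hx => ?_
      change (1 : ENNReal) ≤ ((ψ x).toNNReal : ENNReal)
      simp [hψ1 hx]
    _ ≤ ∫⁻ x, F x ∂(NNRealRMK.rieszMeasure Φ) := setLIntegral_le_lintegral _ _
    _ = Φ F := NNRealRMK.lintegral_rieszMeasure Φ F
    _ ≤ C := ENNReal.coe_le_coe.2 (h F fun x => Real.toNNReal_le_one.2 (hψ x).2)

/-- Finitely many bounded functionals on `C₀(L, 𝕜)` are dominated by the integral against a common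
nonzero finite regular measure. -/
theorem exists_measure_norm_le_integral [Nonempty L] {ι : Type*} [Fintype ι]
    (Λ : ι → StrongDual 𝕜 C₀(L, 𝕜)) :
    ∃ μ : Measure L, IsFiniteMeasure μ ∧ μ.Regular ∧ μ ≠ 0 ∧
      ∀ i f, ‖Λ i f‖ ≤ ∫ x, ‖f x‖ ∂μ := by
  obtain ⟨x₀⟩ := ‹Nonempty L›
  let ev : C_c(L, ℝ≥0) →ₗ[ℝ≥0] ℝ≥0 :=
    { toFun := fun f => f x₀, map_add' := fun _ _ => rfl, map_smul' := fun _ _ => rfl }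
  -- The evaluation keeps the measure nonzero even if every `Λ i` vanishes. This later gives `0 <
  -- m`, needed for `‖P‖ = 1`.
  let Φ := ∑ i, dualAbsₗ (Λ i) + ev
  have hΦ : ∀ f, Φ f = ∑ i, dualAbs (Λ i) f + f x₀ := fun f => by
    simp only [Φ, LinearMap.add_apply, LinearMap.sum_apply]; rfl
  have hfin : IsFiniteMeasure (NNRealRMK.rieszMeasure Φ) := by
    refine isFiniteMeasure_rieszMeasure Φ (∑ i, ‖Λ i‖₊ * 1 + 1) fun f hf => ?_
    rw [hΦ]
    gcongr
    · exact dualAbs_le _ hf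
    · exact hf x₀
  refine ⟨NNRealRMK.rieszMeasure Φ, hfin, inferInstance, fun h0 => ?_, fun i =>
    norm_le_integral (Λ i) fun f => ?_⟩
  · obtain ⟨ψ, hψ1, hψc, -, hψ⟩ := exists_continuousMap_one_of_isCompact_subset_isOpen
      (isCompact_singleton (x := x₀)) isOpen_univ (Set.subset_univ _)
    let F : C_c(L, ℝ≥0) := ⟨⟨fun x => (ψ x).toNNReal, by fun_prop⟩, by
      refine HasCompactSupport.intro hψc fun x hx => ?_
      simp [image_eq_zero_of_notMem_tsupport hx]⟩
    have h1 := NNRealRMK.lintegral_rieszMeasure Φ F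
    rw [h0, lintegral_zero_measure] at h1
    have h2 : F x₀ = 1 := by
      change (ψ x₀).toNNReal = 1
      simp [hψ1 rfl]
    have h3 : Φ F = 0 := by exact_mod_cast h1.symm
    rw [hΦ, h2] at h3
    simp at h3
  · rw [NNRealRMK.lintegral_rieszMeasure, ENNReal.coe_le_coe, hΦ]
    exact (Finset.single_le_sum (f := fun i => dualAbs (Λ i) f) (fun _ _ => zero_le)
      (Finset.mem_univ i)).trans le_self_add

end ZeroAtInftyContinuousMap

/-! ### Simple functions and compact subsets of their fibres. -/

namespace ZeroAtInftyContinuousMap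

variable {𝕜 L : Type*} [RCLike 𝕜] [TopologicalSpace L] [MeasurableSpace L] [BorelSpace L]

/-- A function vanishing at infinity is uniformly close to a simple function. -/
theorem exists_simpleFunc_norm_sub_lt (f : C₀(L, 𝕜)) {ε : ℝ} (hε : 0 < ε) :
    ∃ r : SimpleFunc L 𝕜, ∀ x, ‖f x - r x‖ < ε := by
  have htb : TotallyBounded (Set.range f) := 
    (Metric.isCompact_of_isClosed_isBounded isClosed_closure
      (ZeroAtInftyContinuousMap.isBounded_range f).closure).totallyBounded.subset subset_closure
  obtain ⟨t, ht, hcov⟩ := Metric.totallyBounded_iff.1 htb ε hε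
  obtain ⟨l, hl⟩ : ∃ l : List 𝕜, ∀ y, y ∈ l ↔ y ∈ t := ⟨ht.toFinset.toList, by simp⟩
  -- `nearestPt e l.length` also tries the index `l.length`, where `e` is the default `0`; an extra
  -- candidate only improves the approximation.
  let e : ℕ → 𝕜 := fun n => l.getD n 0
  refine ⟨(SimpleFunc.nearestPt e l.length).comp f (map_continuous f).measurable, fun x => ?_⟩
  have hx := hcov ⟨x, rfl⟩
  simp only [Set.mem_iUnion, Metric.mem_ball] at hx
  obtain ⟨y, hy, hxy⟩ := hx
  obtain ⟨n, hn, rfl⟩ := List.getElem_of_mem ((hl y).2 hy)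
  have h1 := SimpleFunc.edist_nearestPt_le e (f x) hn.le
  rw [edist_dist, edist_dist, ENNReal.ofReal_le_ofReal_iff dist_nonneg] at h1
  rw [← dist_eq_norm, dist_comm, SimpleFunc.coe_comp, Function.comp_apply]
  refine h1.trans_lt ?_
  rw [dist_comm]
  simpa [e, hn] using hxy

variable [T2Space L]

theorem exists_isCompact_measure_pos_sdiff_lt {μ : Measure L} [IsFiniteMeasure μ] [μ.Regular]
    {A : Set L} (hA : MeasurableSet A) (h0 : μ A ≠ 0) {η : ℝ} (hη : 0 < η) :
    ∃ K ⊆ A, IsCompact K ∧ 0 < μ K ∧ μ.real (A \ K) < η := by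
  obtain ⟨K, hKA, hK, hlt⟩ := hA.exists_isCompact_sdiff_lt (measure_ne_top μ A)
    -- The bound by `μ A` forces `μ K > 0`.
    (ε := min (ENNReal.ofReal η) (μ A)) (by simp [h0, hη])
  refine ⟨K, hKA, hK, pos_iff_ne_zero.2 fun h => ?_, ?_⟩
  · rw [measure_sdiff_null h] at hlt
    exact absurd (hlt.trans_le (min_le_right _ _)) (lt_irrefl _)
  · exact ENNReal.toReal_lt_of_lt_ofReal (hlt.trans_le (min_le_left _ _))

/-- Compact subsets of the non-null fibres of a simple function, exhausting a finite regular
measure up to a small remainder. -/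
theorem _root_.MeasureTheory.SimpleFunc.exists_isCompact_fibers {α : Type*} {μ : Measure L}
    [IsFiniteMeasure μ] [μ.Regular] (hμ : μ ≠ 0) (F : SimpleFunc L α) {η : ℝ} (hη : 0 < η) :
    ∃ (m : ℕ) (K : Fin m → Set L) (v : Fin m → α), 0 < m ∧ (∀ j, IsCompact (K j)) ∧
      Pairwise (Function.onFun Disjoint K) ∧ (∀ j, 0 < μ (K j)) ∧ (∀ j, ∀ x ∈ K j, F x = v j) ∧
      μ.real (⋃ j, K j)ᶜ ≤ η := by
  classical
  let R := F.range.filter fun v => μ (F ⁻¹' {v}) ≠ 0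
  set ρ : ℝ := η / (R.card + 1)
  have hρ : 0 < ρ := by positivity
  have hex : ∀ v : R, ∃ K ⊆ F ⁻¹' {v.1}, IsCompact K ∧ 0 < μ K ∧ μ.real (F ⁻¹' {v.1} \ K) < ρ :=
    fun v => exists_isCompact_measure_pos_sdiff_lt (F.measurableSet_fiber _)
      (Finset.mem_filter.1 v.2).2 hρ
  choose K hKs hKc hKp hKd using hex
  have hcov : μ.real (⋃ v, K v)ᶜ ≤ ∑ v : R, μ.real (F ⁻¹' {v.1} \ K v) := by
    have hnull : μ (⋃ v ∈ {v ∈ F.range | μ (F ⁻¹' {v}) = 0}, F ⁻¹' {v}) = 0 :=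
      (measure_biUnion_null_iff (Finset.countable_toSet _)).2 fun v hv =>
        (Finset.mem_filter.1 hv).2
    have hsub : (⋃ v, K v)ᶜ ⊆ (⋃ v ∈ {v ∈ F.range | μ (F ⁻¹' {v}) = 0}, F ⁻¹' {v}) ∪
        ⋃ v : R, F ⁻¹' {v.1} \ K v := by
      intro x hx
      by_cases h : μ (F ⁻¹' {F x}) = 0
      · left
        simp only [Set.mem_iUnion]
        exact ⟨F x, Finset.mem_filter.2 ⟨F.mem_range_self x, h⟩, rfl⟩
      · right
        simp only [Set.mem_iUnion]
        refine ⟨⟨F x, Finset.mem_filter.2 ⟨F.mem_range_self x, h⟩⟩, rfl, fun hxK => hx ?_⟩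
        exact Set.mem_iUnion.2 ⟨_, hxK⟩
    refine (measureReal_mono hsub).trans ((measureReal_union_le _ _).trans ?_)
    rw [measureReal_def, hnull, ENNReal.toReal_zero, zero_add]
    exact measureReal_iUnion_fintype_le _
  have hR : 0 < R.card := by
    rw [Finset.card_pos, Finset.nonempty_iff_ne_empty]
    intro hR
    apply hμ
    rw [← Measure.measure_univ_eq_zero]
    have : (Set.univ : Set L) = ⋃ v ∈ F.range, F ⁻¹' {v} := by
      ext x; simp
    rw [this]
    refine (measure_biUnion_null_iff (Finset.countable_toSet _)).2 fun v hv => ?_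
    by_contra h
    exact (Finset.notMem_empty v) (hR ▸ Finset.mem_filter.2 ⟨hv, h⟩)
  refine ⟨R.card, fun j => K (R.equivFin.symm j), fun j => (R.equivFin.symm j).1, hR,
    fun j => hKc _, fun i j hij => ?_, fun j => hKp _, fun j x hx => hKs _ hx, ?_⟩
  · refine Set.disjoint_left.2 fun x hi hj => hij ?_
    refine R.equivFin.symm.injective (Subtype.ext ?_)
    exact (hKs _ hi : F x = _).symm.trans (hKs _ hj)
  · rw [R.equivFin.symm.surjective.iUnion_comp K]
    refine hcov.trans ((Finset.sum_le_sum fun v _ => (hKd v).le).trans ?_)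
    rw [Finset.sum_const, nsmul_eq_mul, Finset.card_univ, Fintype.card_coe, mul_div_assoc',
      div_le_iff₀ (by positivity)]
    nlinarith

/-- If `w` is `L¹`-close to a function constant on each of the compact sets `K j`, which exhaust the
measure up to a small remainder, then integration against `w` is small on the functions with
vanishing averages over the sets `K j`. -/
theorem norm_integral_mul_le {μ : Measure L} [IsFiniteMeasure μ] {m : ℕ} {K : Fin m → Set L}
    (hKc : ∀ j, IsCompact (K j)) (hKd : Pairwise (Function.onFun Disjoint K)) {w : L → 𝕜}
    (hw : Integrable w μ) {s : L → 𝕜} (hs : Integrable s μ) {M : ℝ} (hM : ∀ x, ‖s x‖ ≤ M)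
    {a : Fin m → 𝕜} (ha : ∀ j, ∀ x ∈ K j, s x = a j)
    (g : C₀(L, 𝕜)) (hg : ∀ j, ∫ x in K j, g x ∂μ = 0) :
    ‖∫ x, g x * w x ∂μ‖ ≤
      ‖g‖ * (∫ x, ‖w x - s x‖ ∂μ + M * μ.real (⋃ j, K j)ᶜ) := by
  set U := ⋃ j, K j
  have hU : MeasurableSet U := MeasurableSet.iUnion fun j => (hKc j).measurableSet
  have hmul : ∀ {u : L → 𝕜}, Integrable u μ → Integrable (fun x => g x * u x) μ := fun hu =>
    hu.bdd_mul (g.integrable μ).1 (Filter.Eventually.of_forall (norm_apply_le g))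
  -- On each `K j` the factor `s` is a constant multiplying a zero integral.
  have hUs : ∫ x in U, g x * s x ∂μ = 0 := by
    rw [integral_iUnion_fintype (fun j => (hKc j).measurableSet) hKd
      fun j => (hmul hs).integrableOn]
    refine Finset.sum_eq_zero fun j _ => ?_
    rw [setIntegral_congr_fun (g := fun x => g x * a j) (hKc j).measurableSet
      fun x hx => by simp only [ha j x hx], integral_mul_const, hg, zero_mul]
  have hsplit : ∫ x, g x * w x ∂μ
      = ∫ x, g x * (w x - s x) ∂μ + ∫ x in Uᶜ, g x * s x ∂μ := by
    have h1 := integral_add_compl hU (hmul hs)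
    rw [hUs, zero_add] at h1
    have h2 := integral_add (hmul (hw.sub hs)) (hmul hs)
    simp only [Pi.sub_apply] at h2
    rw [h1, ← h2]
    simp [mul_sub]
  rw [hsplit, mul_add]
  refine (norm_add_le _ _).trans (add_le_add ?_ ?_)
  · rw [← integral_const_mul]
    refine norm_integral_le_of_norm_le ((hw.sub hs).norm.const_mul _)
      (Filter.Eventually.of_forall fun x => ?_)
    rw [norm_mul]
    gcongr
    exact norm_apply_le g x
  · rw [← mul_assoc]
    refine norm_setIntegral_le_of_norm_le_const (measure_lt_top _ _) fun x _ => ?_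
    rw [norm_mul]
    exact mul_le_mul (norm_apply_le g x) (hM x) (norm_nonneg _) (norm_nonneg _)

/-- For finitely many integrable densities there are disjoint compact sets such that integration
against each density is small on the functions with vanishing averages over the sets. -/
theorem exists_isCompact_norm_integral_mul_le {ι : Type*} [Fintype ι] {μ : Measure L}
    [IsFiniteMeasure μ] [μ.Regular] (hμ : μ ≠ 0) {w : ι → L → 𝕜} (hw : ∀ i, Integrable (w i) μ)
    (f₀ : C₀(L, 𝕜)) {ε δ : ℝ} (hε : 0 < ε) (hδ : 0 < δ) :
    ∃ (m : ℕ) (K : Fin m → Set L), 0 < m ∧ (∀ j, IsCompact (K j)) ∧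
      Pairwise (Function.onFun Disjoint K) ∧ (∀ j, 0 < μ (K j)) ∧
      (∀ j, ∀ x ∈ K j, ∀ y ∈ K j, ‖f₀ x - f₀ y‖ ≤ ε) ∧
      ∀ g : C₀(L, 𝕜), (∀ j, ∫ x in K j, g x ∂μ = 0) → ∀ i, ‖∫ x, g x * w i x ∂μ‖ ≤ δ * ‖g‖ := by
  obtain ⟨r, hr⟩ := exists_simpleFunc_norm_sub_lt f₀ (half_pos hε)
  -- Bundling the densities lets one simple function approximate all of them; pairing it with `r`
  -- makes both constant on each `K j`.
  let W : L → ι → 𝕜 := fun x i => w i x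
  have hW : Integrable W μ := Integrable.of_eval hw
  obtain ⟨S, hS, hSi⟩ := (memLp_one_iff_integrable.2 hW).exists_simpleFunc_eLpNorm_sub_lt
    (by simp) (ε := ENNReal.ofReal (δ / 2)) (by simp [hδ])
  rw [memLp_one_iff_integrable] at hSi
  obtain ⟨M, hM⟩ := S.exists_forall_norm_le
  have hM' : ∀ x, ‖S x‖ ≤ |M| := fun x => (hM x).trans (le_abs_self M)
  obtain ⟨m, K, v, hm, hKc, hKd, hKp, hv, hη⟩ :=
    (S.pair r).exists_isCompact_fibers hμ (η := δ / (2 * (|M| + 1))) (by positivity)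
  have hWS : ∫ x, ‖W x - S x‖ ∂μ ≤ δ / 2 := by
    refine (integral_norm_eq_lintegral_enorm (hW.sub hSi).1).trans_le ?_
    refine ENNReal.toReal_le_of_le_ofReal (half_pos hδ).le ?_
    rw [eLpNorm_one_eq_lintegral_enorm] at hS
    exact hS.le
  refine ⟨m, K, hm, hKc, hKd, hKp, fun j x hx y hy => ?_, fun g hg i => ?_⟩
  · have hxy : r x = r y := by
      have := (hv j x hx).trans (hv j y hy).symm
      rw [SimpleFunc.pair_apply, SimpleFunc.pair_apply] at this
      exact (Prod.mk.inj this).2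
    calc ‖f₀ x - f₀ y‖ = ‖(f₀ x - r x) - (f₀ y - r y)‖ := by rw [hxy]; congr 1; abel
      _ ≤ ‖f₀ x - r x‖ + ‖f₀ y - r y‖ := norm_sub_le _ _
      _ ≤ ε := by linarith [hr x, hr y]
  · have hsi : Integrable (fun x => S x i) μ := hSi.eval i
    refine (norm_integral_mul_le hKc hKd (hw i) hsi (M := |M|)
      (fun x => (norm_le_pi_norm (S x) i).trans (hM' x)) (a := fun j => (v j).1 i)
      (fun j x hx => by rw [← hv j x hx]; rfl) g hg).trans ?_
    rw [mul_comm δ]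
    gcongr
    have h1 : ∫ x, ‖w i x - S x i‖ ∂μ ≤ δ / 2 := (integral_mono ((hw i).sub hsi).norm
      (hW.sub hSi).norm fun x => norm_le_pi_norm (W x - S x) i).trans hWS
    have h2 : |M| * μ.real (⋃ j, K j)ᶜ ≤ δ / 2 := by
      refine (mul_le_mul_of_nonneg_left hη (abs_nonneg M)).trans ?_
      rw [mul_div_assoc', div_le_div_iff₀ (by positivity) two_pos]
      nlinarith [abs_nonneg M]
    linarith

end ZeroAtInftyContinuousMap

/-! ### Compactness of the adjoint. -/

/-- The adjoint of a compact operator maps the dual unit ball to a totally bounded set. -/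
theorem IsCompactOperator.exists_finite_norm_sub_comp_le {𝕜 E Y : Type*} [RCLike 𝕜]
    [NormedAddCommGroup E] [NormedSpace 𝕜 E] [NormedAddCommGroup Y] [NormedSpace 𝕜 Y]
    {T : E →L[𝕜] Y} (hT : IsCompactOperator T) {δ : ℝ} (hδ : 0 < δ) :
    ∃ s : Set (StrongDual 𝕜 Y), s.Finite ∧
      ∀ l : StrongDual 𝕜 Y, ‖l‖ ≤ 1 → ∃ l' ∈ s, ‖(l - l') ∘L T‖ ≤ δ := by
  obtain ⟨C, hC, hCT⟩ := IsCompactOperator.image_closedBall_subset_compact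
    (f := (T : E →ₗ[𝕜] Y)) hT 1
  obtain ⟨t, -, ht, hcov⟩ := Metric.finite_approx_of_totallyBounded hC.totallyBounded (δ / 3)
    (by positivity)
  have := ht.fintype
  -- Functionals in the unit ball that nearly agree on the finite net `t` nearly agree on the image
  -- of the unit ball, and restriction to `t` lands in a finite-dimensional space.
  let ev : StrongDual 𝕜 Y → t → 𝕜 := fun l y => l y
  let B : Set (StrongDual 𝕜 Y) := {l | ‖l‖ ≤ 1}
  have hB : TotallyBounded (ev '' B) := by
    have hb : Bornology.IsBounded (ev '' B) := by
      refine isBounded_iff_forall_norm_le.2 ⟨∑ y : t, ‖(y : Y)‖, ?_⟩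
      rintro _ ⟨l, hl, rfl⟩
      refine (pi_norm_le_iff_of_nonneg (Finset.sum_nonneg fun _ _ => norm_nonneg _)).2 fun y => ?_
      refine (l.le_of_opNorm_le hl y).trans ?_
      rw [one_mul]
      exact Finset.single_le_sum (f := fun y : t => ‖(y : Y)‖) (fun _ _ => norm_nonneg _)
        (Finset.mem_univ y)
    exact (Metric.isCompact_of_isClosed_isBounded isClosed_closure
      hb.closure).totallyBounded.subset subset_closure
  obtain ⟨r, hrB, hr, hrcov⟩ := Metric.finite_approx_of_totallyBounded hB (δ / 3) (by positivity)
  -- The net lies in `ev '' B`, so its lifts have norm at most one, as `h4` requires.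
  have hpre : ∀ v : r, ∃ l ∈ B, ev l = v := fun v => hrB v.2
  choose q hqB hq using hpre
  have := hr.fintype
  refine ⟨Set.range q, Set.finite_range q, fun l hl => ?_⟩
  have hlr := hrcov ⟨l, hl, rfl⟩
  simp only [Set.mem_iUnion, Metric.mem_ball] at hlr
  obtain ⟨v, hv, hlv⟩ := hlr
  refine ⟨q ⟨v, hv⟩, ⟨_, rfl⟩, ?_⟩
  set l' := q ⟨v, hv⟩
  have hball : ∀ f, ‖f‖ ≤ 1 → ‖(l - l') (T f)‖ ≤ δ := fun f hf => by
    have hTf := hcov (hCT ⟨f, by simpa using hf, rfl⟩)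
    simp only [Set.mem_iUnion, Metric.mem_ball] at hTf
    obtain ⟨y, hy, hfy⟩ := hTf
    have h1 : ‖l y - l' y‖ < δ / 3 := by
      rw [← show ev l' = v from hq ⟨v, hv⟩, dist_eq_norm] at hlv
      exact (norm_le_pi_norm (ev l - ev l') ⟨y, hy⟩).trans_lt hlv
    have h2 : ‖T f - y‖ ≤ δ / 3 := by rw [← dist_eq_norm]; exact hfy.le
    have h3 : ‖l (T f - y)‖ ≤ 1 * (δ / 3) := l.le_of_opNorm_le_of_le hl h2
    have h4 : ‖l' (T f - y)‖ ≤ 1 * (δ / 3) := l'.le_of_opNorm_le_of_le (hqB _) h2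
    calc ‖(l - l') (T f)‖ = ‖l (T f - y) - l' (T f - y) + (l y - l' y)‖ := by
          congr 1; simp only [map_sub, sub_apply]; ring
      _ ≤ ‖l (T f - y)‖ + ‖l' (T f - y)‖ + ‖l y - l' y‖ :=
        (norm_add_le _ _).trans (add_le_add_left (norm_sub_le _ _) _)
      _ ≤ δ := by linarith
  refine ContinuousLinearMap.opNorm_le_bound _ hδ.le fun f => ?_
  rcases eq_or_ne f 0 with rfl | hf
  · simp
  · have hf0 : 0 < ‖f‖ := norm_pos_iff.2 hf
    have := hball (((‖f‖ : ℝ) : 𝕜)⁻¹ • f) (by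
      rw [norm_smul, norm_inv, RCLike.norm_ofReal, abs_norm, inv_mul_cancel₀ hf0.ne'])
    rw [map_smul, map_smul, norm_smul, norm_inv, RCLike.norm_ofReal, abs_norm,
      inv_mul_le_iff₀ hf0, mul_comm] at this
    exact this

/-! ### Urysohn families and averaging projections. -/

namespace ZeroAtInftyContinuousMap

variable {𝕜 L : Type*} [RCLike 𝕜] [TopologicalSpace L] [T2Space L]

/-- Pairwise disjoint compact sets have pairwise disjoint open neighbourhoods. -/
theorem _root_.IsCompact.exists_isOpen_pairwise_disjoint {ι : Type*} [Finite ι] {K : ι → Set L}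
    (hKc : ∀ j, IsCompact (K j)) (hKd : Pairwise (Function.onFun Disjoint K)) :
    ∃ U : ι → Set L, (∀ j, IsOpen (U j)) ∧ (∀ j, K j ⊆ U j) ∧
      Pairwise (Function.onFun Disjoint U) := by
  have h : ∀ i j, i ≠ j → SeparatedNhds (K i) (K j) := fun i j hij =>
    SeparatedNhds.of_isCompact_isCompact (hKc i) (hKc j) (hKd hij)
  choose! V W hV hW hKV hKW hVW using h
  -- The choices for `(i, j)` and `(j, i)` are unrelated, so both are intersected.
  refine ⟨fun i => ⋂ j : {j // i ≠ j}, V i j ∩ W j i, fun i => ?_, fun i => ?_, fun i j hij => ?_⟩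
  · exact isOpen_iInter_of_finite fun j => (hV i j j.2).inter (hW j i j.2.symm)
  · exact Set.subset_iInter fun j => Set.subset_inter (hKV i j j.2) (hKW j i j.2.symm)
  · refine Set.disjoint_left.2 fun x hi hj => ?_
    exact Set.disjoint_left.1 (hVW i j hij) (Set.mem_iInter.1 hi ⟨j, hij⟩).1
      (Set.mem_iInter.1 hj ⟨i, hij.symm⟩).2

/-- Urysohn functions with disjoint supports for finitely many pairwise disjoint compact sets. -/
theorem exists_urysohn_family [LocallyCompactSpace L] (𝕜 : Type*) [RCLike 𝕜]
    {ι : Type*} [Finite ι] {K : ι → Set L}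
    (hKc : ∀ j, IsCompact (K j)) (hKd : Pairwise (Function.onFun Disjoint K)) :
    ∃ φ : ι → C₀(L, 𝕜),
      (∀ j, (∀ x, ∃ r : ℝ, 0 ≤ r ∧ r ≤ 1 ∧ φ j x = (r : 𝕜)) ∧ ∀ x ∈ K j, φ j x = 1) ∧
      ∀ i j, i ≠ j → Disjoint (tsupport (φ i)) (tsupport (φ j)) := by
  obtain ⟨U, hU, hKU, hUd⟩ := IsCompact.exists_isOpen_pairwise_disjoint hKc hKd
  choose ψ hψ1 hψc hψU hψ using fun j =>
    exists_continuousMap_one_of_isCompact_subset_isOpen (hKc j) (hU j) (hKU j)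
  let φ : ι → C_c(L, 𝕜) := fun j => ⟨⟨fun x => (ψ j x : 𝕜),
    RCLike.continuous_ofReal.comp (ψ j).continuous⟩, HasCompactSupport.intro (hψc j) fun x hx => by
      simp [image_eq_zero_of_notMem_tsupport hx]⟩
  have hφ : ∀ j, tsupport (φ j) ⊆ U j := fun j =>
    (closure_mono fun x (hx : (ψ j x : 𝕜) ≠ 0) => by simpa using hx).trans (hψU j)
  exact ⟨fun j => (φ j : C₀(L, 𝕜)), fun j => ⟨fun x => ⟨ψ j x, (hψ j x).1, (hψ j x).2, rfl⟩,
    fun x hx => by change (ψ j x : 𝕜) = 1; simp [hψ1 j hx]⟩,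
    fun i j hij => (hUd hij).mono (hφ i) (hφ j)⟩

variable [MeasurableSpace L] [BorelSpace L]

/-- The averaging projection attached to pairwise disjoint compact sets and functions with disjoint
supports which are equal to one on these sets. -/
theorem exists_averaging_projection {μ : Measure L} [IsFiniteMeasure μ] {m : ℕ} (hm : 0 < m)
    {K : Fin m → Set L} (hKc : ∀ j, IsCompact (K j)) (hKp : ∀ j, 0 < μ (K j))
    {φ : Fin m → C₀(L, 𝕜)} (hφ : ∀ j x, ‖φ j x‖ ≤ 1) (hφK : ∀ j, ∀ x ∈ K j, φ j x = 1)
    (hφd : ∀ i j, i ≠ j → Disjoint (tsupport (φ i)) (tsupport (φ j))) :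
    ∃ P : C₀(L, 𝕜) →L[𝕜] C₀(L, 𝕜),
      (∀ f, P f = ∑ j, ((1 / (μ.real (K j) : 𝕜)) * ∫ x in K j, f x ∂μ) • φ j) ∧
      (∀ f j, ∫ x in K j, P f x ∂μ = ∫ x in K j, f x ∂μ) ∧
      P ∘L P = P ∧
      LinearMap.range (P : C₀(L, 𝕜) →ₗ[𝕜] C₀(L, 𝕜)) = Submodule.span 𝕜 (Set.range φ) ∧
      ‖P‖ = 1 := by
  have hr : ∀ j, 0 < μ.real (K j) := fun j => ENNReal.toReal_pos (hKp j).ne' (measure_ne_top _ _)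
  have hr' : ∀ j, (μ.real (K j) : 𝕜) ≠ 0 := fun j => RCLike.ofReal_ne_zero.2 (hr j).ne'
  have hφ0 : ∀ i j, i ≠ j → ∀ x, φ i x ≠ 0 → φ j x = 0 := fun i j hij x hx =>
    image_eq_zero_of_notMem_tsupport
      (Set.disjoint_left.1 (hφd i j hij) (subset_tsupport _ hx))
  let A : Fin m → C₀(L, 𝕜) → 𝕜 := fun j f => (1 / (μ.real (K j) : 𝕜)) * ∫ x in K j, f x ∂μ
  have hAadd : ∀ j f g, A j (f + g) = A j f + A j g := fun j f g => by
    simp only [A, add_apply, ← mul_add]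
    rw [integral_add (f.integrable μ).integrableOn (g.integrable μ).integrableOn]
  have hAsmul : ∀ j (c : 𝕜) f, A j (c • f) = c * A j f := fun j c f => by
    simp only [A, smul_apply, smul_eq_mul, integral_const_mul]
    ring
  have hAle : ∀ j f, ‖A j f‖ ≤ ‖f‖ := fun j f => by
    simp only [A, norm_mul, norm_div, norm_one, RCLike.norm_ofReal, abs_of_pos (hr j)]
    rw [one_div, inv_mul_le_iff₀ (hr j), mul_comm]
    exact norm_setIntegral_le_of_norm_le_const (measure_lt_top _ _) fun x _ => norm_apply_le f x
  have hAφ : ∀ j, A j (φ j) = 1 := fun j => by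
    simp only [A]
    rw [setIntegral_congr_fun (g := fun _ => (1 : 𝕜)) (hKc j).measurableSet (hφK j),
      setIntegral_const, RCLike.real_smul_eq_coe_mul, mul_one, one_div_mul_cancel (hr' j)]
  let Q : C₀(L, 𝕜) →ₗ[𝕜] C₀(L, 𝕜) :=
    { toFun := fun f => ∑ j, A j f • φ j
      map_add' := fun f g => by
        simp only [hAadd, ← Finset.sum_add_distrib]
        exact Finset.sum_congr rfl fun j _ => ZeroAtInftyContinuousMap.ext fun x => add_mul _ _ _
      map_smul' := fun c f => by
        simp only [hAsmul, mul_smul, Finset.smul_sum, RingHom.id_apply] }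
  have hQx : ∀ f x, Q f x = ∑ j, A j f * φ j x := fun f x => by
    let e : C₀(L, 𝕜) →+ 𝕜 :=
      { toFun := fun f => f x, map_zero' := rfl, map_add' := fun _ _ => rfl }
    exact map_sum e _ _
  -- At most one `φ i` is nonzero at each point, so the sum has a single term and `Q` is a
  -- contraction.
  have hQ1 : ∀ f i x, φ i x ≠ 0 → Q f x = A i f * φ i x := fun f i x hx => by
    rw [hQx, Finset.sum_eq_single i (fun j _ hj => by rw [hφ0 i j hj.symm x hx, mul_zero])
      (fun h => absurd (Finset.mem_univ i) h)]
  have hQle : ∀ f, ‖Q f‖ ≤ 1 * ‖f‖ := fun f => by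
    rw [one_mul, norm_le_iff (norm_nonneg f)]
    intro x
    by_cases h : ∃ i, φ i x ≠ 0
    · obtain ⟨i, hi⟩ := h
      rw [hQ1 f i x hi, norm_mul]
      exact (mul_le_of_le_one_right (norm_nonneg _) (hφ i x)).trans (hAle i f)
    · push Not at h
      rw [hQx]
      simp [h]
  have hQint : ∀ f j, ∫ x in K j, Q f x ∂μ = ∫ x in K j, f x ∂μ := fun f j => by
    rw [setIntegral_congr_fun (g := fun _ => A j f) (hKc j).measurableSet fun x hx => by
      simp only
      rw [hQ1 f j x (by rw [hφK j x hx]; exact one_ne_zero), hφK j x hx, mul_one],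
      setIntegral_const, RCLike.real_smul_eq_coe_mul]
    simp only [A]
    rw [← mul_assoc, mul_one_div_cancel (hr' j), one_mul]
  have hAQ : ∀ f j, A j (Q f) = A j f := fun f j => by
    simp only [A]; rw [hQint]
  have hQQ : ∀ f, Q (Q f) = Q f := fun f => by
    change ∑ j, A j (Q f) • φ j = ∑ j, A j f • φ j
    exact Finset.sum_congr rfl fun j _ => congrArg (· • φ j) (hAQ f j)
  have hQφ : ∀ i, Q (φ i) = φ i := fun i => by
    ext x
    by_cases hx : φ i x = 0
    · rw [hQx, hx]
      refine Finset.sum_eq_zero fun j _ => ?_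
      rcases eq_or_ne j i with rfl | hij
      · rw [hx, mul_zero]
      · have : A j (φ i) = 0 := by
          simp only [A]
          rw [setIntegral_congr_fun (g := fun _ => (0 : 𝕜)) (hKc j).measurableSet fun y hy =>
            hφ0 j i hij y (by rw [hφK j y hy]; exact one_ne_zero)]
          simp
        rw [this, zero_mul]
    · rw [hQ1 _ i x hx, hAφ, one_mul]
  refine ⟨Q.mkContinuous 1 hQle, fun f => rfl, hQint, ?_, ?_, ?_⟩
  · ext1 f; exact hQQ f
  · refine le_antisymm ?_ (Submodule.span_le.2 ?_)
    · rintro _ ⟨f, rfl⟩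
      change ∑ j, A j f • φ j ∈ Submodule.span 𝕜 (Set.range φ)
      exact Submodule.sum_mem _ fun j _ =>
        Submodule.smul_mem _ _ (Submodule.subset_span (Set.mem_range_self j))
    · rintro _ ⟨i, rfl⟩
      exact ⟨φ i, hQφ i⟩
  · refine le_antisymm (Q.mkContinuous_norm_le zero_le_one hQle) ?_
    -- `Q` fixes the nonzero function `φ i`, so its norm is at least one.
    let i : Fin m := ⟨0, hm⟩
    obtain ⟨x, hx⟩ : (K i).Nonempty := nonempty_of_measure_ne_zero (hKp i).ne'
    have hpos : 0 < ‖φ i‖ := by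
      refine zero_lt_one.trans_le ?_
      simpa [hφK i x hx] using norm_apply_le (φ i) x
    have := (Q.mkContinuous 1 hQle).le_opNorm (φ i)
    rw [LinearMap.mkContinuous_apply, hQφ] at this
    exact le_of_mul_le_mul_right (by rwa [one_mul]) hpos

end ZeroAtInftyContinuousMap

/-! ### The approximation theorem. -/

theorem proposition3p2 {𝕜 : Type*} [RCLike 𝕜]
    {L : Type*} [TopologicalSpace L] [LocallyCompactSpace L] [T2Space L] [Nonempty L]
    [MeasurableSpace L] [BorelSpace L]
    {Y : Type*} [NormedAddCommGroup Y] [NormedSpace 𝕜 Y] [CompleteSpace Y]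
    (ε : ℝ) (hε : 0 < ε)
    (T : C₀(L, 𝕜) →L[𝕜] Y) (hT : IsCompactOperator T) (f₀ : C₀(L, 𝕜)) :
    ∃ (μ : MeasureTheory.Measure L) (m : ℕ) (K : Fin m → Set L) (φ : Fin m → C₀(L, 𝕜)),
      MeasureTheory.IsFiniteMeasure μ ∧ μ.Regular ∧
      (∀ j, IsCompact (K j)) ∧
      (∀ i j, i ≠ j → Disjoint (K i) (K j)) ∧
      (∀ j, 0 < μ (K j)) ∧
      (∀ j, setOsc f₀ (K j) < ε) ∧
      (∀ j, (∀ x, ∃ r : ℝ, 0 ≤ r ∧ r ≤ 1 ∧ φ j x = (r : 𝕜)) ∧ ∀ x ∈ K j, φ j x = 1) ∧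
      (∀ i j, i ≠ j → Disjoint (tsupport (φ i)) (tsupport (φ j))) ∧
      ∃ P : C₀(L, 𝕜) →L[𝕜] C₀(L, 𝕜),
        (∀ f : C₀(L, 𝕜),
          P f = ∑ j, ((1 / (μ.real (K j) : 𝕜)) * ∫ x in K j, f x ∂μ) • φ j) ∧
        P ∘L P = P ∧
        LinearMap.range (P : C₀(L, 𝕜) →ₗ[𝕜] C₀(L, 𝕜)) = Submodule.span 𝕜 (Set.range φ) ∧
        ‖P‖ = 1 ∧
        ‖T - T ∘L P‖ < ε := by
  -- The two errors `δ * ‖g‖` and `‖g‖ ≤ 2 * ‖f‖` give `4 * δ = ε / 2`, which leaves room for strict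
  -- inequality.
  set δ : ℝ := ε / 8 with hδ
  have hδ0 : 0 < δ := by positivity
  obtain ⟨s, hs, hsl⟩ := hT.exists_finite_norm_sub_comp_le hδ0
  have := hs.fintype
  obtain ⟨μ, hμf, hμr, hμ0, hμ⟩ :=
    ZeroAtInftyContinuousMap.exists_measure_norm_le_integral (𝕜 := 𝕜) (L := L)
      fun l : s => (l : StrongDual 𝕜 Y) ∘L T
  choose w hw hwl using fun l : s =>
    ZeroAtInftyContinuousMap.exists_density _ (hμ l)
  obtain ⟨m, K, hm, hKc, hKd, hKp, hosc, hsmall⟩ :=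
    ZeroAtInftyContinuousMap.exists_isCompact_norm_integral_mul_le hμ0 hw f₀ (half_pos hε) hδ0
  obtain ⟨φ, hφ, hφd⟩ := ZeroAtInftyContinuousMap.exists_urysohn_family 𝕜 hKc hKd
  have hφ1 : ∀ j x, ‖φ j x‖ ≤ 1 := fun j x => by
    obtain ⟨r, h0, h1, hr⟩ := (hφ j).1 x
    rwa [hr, RCLike.norm_ofReal, abs_of_nonneg h0]
  obtain ⟨P, hP, hPint, hPP, hPr, hP1⟩ :=
    ZeroAtInftyContinuousMap.exists_averaging_projection hm hKc hKp hφ1 (fun j => (hφ j).2) hφd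
  refine ⟨μ, m, K, φ, hμf, hμr, hKc, fun i j hij => hKd hij, hKp, fun j => ?_, hφ, hφd, P, hP, hPP,
    hPr, hP1, ?_⟩
  · refine lt_of_le_of_lt (Real.sSup_le ?_ (half_pos hε).le) (half_lt_self hε)
    rintro _ ⟨x, hx, y, hy, rfl⟩
    exact hosc j x hx y hy
  · refine lt_of_le_of_lt (ContinuousLinearMap.opNorm_le_bound _ (half_pos hε).le fun f => ?_)
      (half_lt_self hε)
    set g := f - P f with hg
    have hgf : ‖g‖ ≤ 2 * ‖f‖ := by
      have := P.le_opNorm f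
      rw [hP1, one_mul] at this
      linarith [norm_sub_le f (P f)]
    have hg0 : ∀ j, ∫ x in K j, g x ∂μ = 0 := fun j => by
      simp only [hg, ZeroAtInftyContinuousMap.sub_apply]
      rw [integral_sub (f.integrable μ).integrableOn ((P f).integrable μ).integrableOn, hPint,
        sub_self]
    have hTg : (T - T ∘L P) f = T g := by simp [hg]
    rw [hTg]
    obtain ⟨l, hl, hlT⟩ := exists_dual_vector'' 𝕜 (T g)
    obtain ⟨l', hl's, hl'⟩ := hsl l hl
    have h1 : ‖(l - l') (T g)‖ ≤ δ * ‖g‖ := ((l - l') ∘L T).le_of_opNorm_le hl' g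
    have h2 : ‖l' (T g)‖ ≤ δ * ‖g‖ := by
      have := hsmall g hg0 ⟨l', hl's⟩
      rwa [← hwl] at this
    calc ‖T g‖ = ‖l (T g)‖ := by rw [hlT, RCLike.norm_ofReal, abs_norm]
      _ = ‖(l - l') (T g) + l' (T g)‖ := by simp
      _ ≤ δ * ‖g‖ + δ * ‖g‖ := (norm_add_le _ _).trans (add_le_add h1 h2)
      _ = 2 * δ * ‖g‖ := by ring
      _ ≤ 2 * δ * (2 * ‖f‖) := by gcongr
      _ = ε / 2 * ‖f‖ := by rw [hδ]; ring
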